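/- Let $E=(E_0,E_1,s,r)$ be a directed graph ($E_0$, $E_1$ arbitrary sets, $s,r:E_1\to E_0$). The complex Leavitt path algebra $L=L_{\mathbb C}(E)$ is the (not necessarily unital) associative $\mathbb C$-algebra generated by the vertices $v\in E_0$, the edges $e\in E_1$ and ghost edges $e^\ast$ ($e\in E_1$) subject to the following relations for all $v,w\in E_0$ and $e,f\in E_1$: $vw=\delta_{v,w}v$; $s(e)e=e=e\,r(e)$; $r(e)e^\ast=e^\ast=e^\ast s(e)$; $e^\ast f=\delta_{e,f}\,r(e)$; and $\sum_{e\in s^{-1}(v)}ee^\ast=v$ for every vertex $v$ with $0<|s^{-1}(v)|<\infty$. It is $\mathbb Z$-graded, $L=\bigoplus_{n\in\mathbb Z}L_n$, by $\deg v=0$, $\deg e=1$, $\deg e^\ast=-1$, and carries the conjugate-linear anti-multiplicative involution ${}^\ast$ that fixes every vertex and interchanges $e$ and $e^\ast$; it satisfies $(L_n)^\ast=L_{-n}$. A module frame system for $L$, when $L$ has an identity $1$, is a family $(x_n,y_n)_{n\in\mathbb Z}$ such that for every $n$ there is a positive integer $k_n$ for which $x_n$ is a column of length $k_n$ with entries in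 $L_n$, $y_n$ is a column of length $k_n$ with entries in $L_{-n}$, and $y_n^t x_n=1$; moreover $k_0=1$ and $x_0=y_0=1$. **Theorem.** Suppose that $L_{\mathbb C}(E)$ is unital. Then $L_{\mathbb C}(E)$ has the algebraic Parseval property, i.e. it admits a module frame system of the form $(z_n,z_n^\ast)_{n\in\mathbb Z}$, where $z_n^\ast$ is obtained from $z_n$ by applying ${}^\ast$ to each entry, if and only if it is strongly $\mathbb Z$-graded, i.e. $L_mL_n=L_{m+n}$ for all $m,n\in\mathbb Z$, where $L_mL_n$ is the set of finite sums of products $ab$ with $a\in L_m$, $b\in L_n$. -/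

import Mathlib

/-! ## Graded rings and graded star-rings

Rings are not assumed to have an identity. Grading groups are written additively.
Where an identity is needed, it is passed as an explicit element `one`. -/

/-- `one` is a (two-sided) identity of the possibly non-unital ring `S`. -/
def IsRingIdentity {S : Type*} [NonUnitalRing S] (one : S) : Prop :=
  ∀ a : S, one * a = a ∧ a * one = a

/-- A `G`-grading of `S`: a direct sum decomposition of `S` into additive subgroups `S_g` with
`S_g S_h ⊆ S_{g + h}`. -/
structure RingGrading (G S : Type*) [AddGroup G] [DecidableEq G] [NonUnitalRing S] where
  comp : G → AddSubgroup S
  isInternal : DirectSum.IsInternal comp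
  mul_mem : ∀ (g h : G) (a b : S), a ∈ comp g → b ∈ comp h → a * b ∈ comp (g + h)

/-- A grading of a star-ring which is compatible with the involution: `(S_g)^* = S_{-g}`. -/
structure StarRingGrading (G S : Type*) [AddGroup G] [DecidableEq G] [NonUnitalRing S]
    [StarRing S] extends RingGrading G S where
  star_comp : ∀ g : G, (fun a : S => star a) '' (comp g : Set S) = (comp (-g) : Set S)

/-- Strongly graded: `S_g S_h = S_{g + h}` for all `g, h`, where `S_g S_h` is the set of finite sums
of products, i.e. the additive subgroup generated by all products. -/
def RingGrading.IsStrong {G S : Type*} [AddGroup G] [DecidableEq G] [NonUnitalRing S]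
    (𝒮 : RingGrading G S) : Prop :=
  ∀ g h : G,
    AddSubgroup.closure {c : S | ∃ a ∈ 𝒮.comp g, ∃ b ∈ 𝒮.comp h, c = a * b} = 𝒮.comp (g + h)

/-- `(x_g, y_g)_g` is a module frame system: `x_g` and `y_g` are columns of positive length `n_g`
with entries in `S_g` and `S_{-g}` respectively, `y_g^t x_g = 1`, and `n_0 = 1`,
`x_0 = y_0 = 1` at the neutral element. -/
structure RingGrading.IsModuleFrameSystem {G S : Type*} [AddGroup G] [DecidableEq G]
    [NonUnitalRing S] (𝒮 : RingGrading G S) (one : S) (n : G → ℕ)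
    (x y : (g : G) → Fin (n g) → S) : Prop where
  pos : ∀ g, 0 < n g
  mem_left : ∀ g i, x g i ∈ 𝒮.comp g
  mem_right : ∀ g i, y g i ∈ 𝒮.comp (-g)
  sum_eq : ∀ g, ∑ i, y g i * x g i = one
  size_zero : n 0 = 1
  left_zero : ∀ i, x 0 i = one
  right_zero : ∀ i, y 0 i = one

/-- The algebraic Parseval property: there is a module frame system of the form `(z_g, z_g^*)_g`,
where `z_g^*` is the column obtained by applying the involution to every entry of `z_g`. -/
def StarRingGrading.HasAlgebraicParseval {G S : Type*} [AddGroup G] [DecidableEq G]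
    [NonUnitalRing S] [StarRing S] (𝒮 : StarRingGrading G S) (one : S) : Prop :=
  ∃ (n : G → ℕ) (z : (g : G) → Fin (n g) → S),
    𝒮.toRingGrading.IsModuleFrameSystem one n z (fun g i => star (z g i))

/-! ## Leavitt path algebras -/

/-- A directed graph with vertex set `V`, edge set `E`, source and range maps. -/
structure DirectedGraph (V E : Type*) where
  source : E → V
  range : E → V

/-- The generators: vertices, edges and ghost edges. -/
inductive LeavittGen (V E : Type*) where
  | vertex : V → LeavittGen V E
  | edge : E → LeavittGen V E
  | ghost : E → LeavittGen V E

namespace LeavittGen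

variable {V E : Type*}

/-- The degree of a generator. -/
def degree : LeavittGen V E → ℤ
  | vertex _ => 0
  | edge _ => 1
  | ghost _ => -1

/-- The involution on generators. -/
def adj : LeavittGen V E → LeavittGen V E
  | vertex v => vertex v
  | edge e => ghost e
  | ghost e => edge e

theorem adj_adj (x : LeavittGen V E) : x.adj.adj = x := by cases x <;> rfl

theorem degree_adj (x : LeavittGen V E) : x.adj.degree = -x.degree := by
  cases x <;> simp [adj, degree]

end LeavittGen

/-- Nonempty words in the generators. -/
abbrev LeavittWord (V E : Type*) := FreeSemigroup (LeavittGen V E)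

namespace LeavittWord

variable {V E : Type*}

/-- The degree of a word: the sum of the degrees of its letters. -/
def degree (w : LeavittWord V E) : ℤ :=
  Multiplicative.toAdd (FreeSemigroup.lift (fun x => Multiplicative.ofAdd x.degree) w)

/-- The adjoint of a word: reverse it, and take the adjoint of each letter. -/
def adj (w : LeavittWord V E) : LeavittWord V E :=
  MulOpposite.unop (FreeSemigroup.lift (fun x => MulOpposite.op (FreeSemigroup.of x.adj)) w)

theorem degree_of (x : LeavittGen V E) : degree (FreeSemigroup.of x) = x.degree := by
  simp [degree]

theorem degree_mul (w w' : LeavittWord V E) : degree (w * w') = degree w + degree w' := by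
  simp [degree]

theorem adj_of (x : LeavittGen V E) :
    adj (FreeSemigroup.of x) = FreeSemigroup.of x.adj := by
  simp [adj]

theorem adj_mul (w w' : LeavittWord V E) : adj (w * w') = adj w' * adj w := by
  simp [adj]

theorem adj_adj (w : LeavittWord V E) : adj (adj w) = w := by
  induction w using FreeSemigroup.recOnMul with
  | ih1 x => simp [adj_of, LeavittGen.adj_adj]
  | ih2 x y hx hy => rw [adj_mul, adj_mul, hx, hy]

theorem degree_adj (w : LeavittWord V E) : degree (adj w) = -degree w := by
  induction w using FreeSemigroup.recOnMul with
  | ih1 x => simp [adj_of, degree_of, LeavittGen.degree_adj]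
  | ih2 x y hx hy => rw [adj_mul, degree_mul, degree_mul, hx, hy]; ring

end LeavittWord

/-- The free (non-unital, associative) complex algebra on the generators. -/
abbrev LeavittFree (V E : Type*) := MonoidAlgebra ℂ (LeavittWord V E)

namespace LeavittFree

variable {V E : Type*}

/-- A generator, as an element of the free algebra. -/
noncomputable def gen (x : LeavittGen V E) : LeavittFree V E :=
  MonoidAlgebra.single (FreeSemigroup.of x) 1

noncomputable abbrev vertex (v : V) : LeavittFree V E := gen (.vertex v)
noncomputable abbrev edge (e : E) : LeavittFree V E := gen (.edge e)
noncomputable abbrev ghost (e : E) : LeavittFree V E := gen (.ghost e)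

/-- The conjugate-linear involution of the free algebra: `c w ↦ conj(c) w^*` for words `w`. -/
noncomputable def adj : LeavittFree V E →+ LeavittFree V E :=
  (Finsupp.liftAddHom fun w =>
    (MonoidAlgebra.singleAddHom (LeavittWord.adj w)).comp (starAddEquiv (R := ℂ)).toAddMonoidHom).comp
    MonoidAlgebra.coeffAddEquiv.toAddMonoidHom

theorem adj_single (w : LeavittWord V E) (c : ℂ) :
    adj (MonoidAlgebra.single w c) = MonoidAlgebra.single (LeavittWord.adj w) (star c) := by
  simp [adj]

theorem adj_gen (x : LeavittGen V E) : adj (gen x) = gen x.adj := by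
  simp [gen, adj_single, LeavittWord.adj_of]

theorem adj_smul (c : ℂ) (a : LeavittFree V E) : adj (c • a) = star c • adj a := by
  induction a using MonoidAlgebra.induction_linear with
  | zero => simp
  | add f g hf hg => rw [smul_add, map_add, hf, hg, map_add, smul_add]
  | single w d => simp [adj_single]

theorem adj_mul (a b : LeavittFree V E) : adj (a * b) = adj b * adj a := by
  induction a using MonoidAlgebra.induction_linear with
  | zero => simp
  | add f g hf hg => rw [add_mul, map_add, hf, hg, map_add, mul_add]
  | single w d =>
    induction b using MonoidAlgebra.induction_linear with
    | zero => simp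
    | add f g hf hg => rw [mul_add, map_add, hf, hg, map_add, add_mul]
    | single w' d' =>
      simp [MonoidAlgebra.single_mul_single, adj_single, LeavittWord.adj_mul, mul_comm]

theorem adj_adj (a : LeavittFree V E) : adj (adj a) = a := by
  induction a using MonoidAlgebra.induction_linear with
  | zero => simp
  | add f g hf hg => rw [map_add, map_add, hf, hg]
  | single w d => simp [adj_single, LeavittWord.adj_adj]

/-- The linear map with `w ↦ 2 ^ deg(w) w`; its eigenspaces separate the degrees. -/
noncomputable def gauge : LeavittFree V E →+ LeavittFree V E :=
  (Finsupp.liftAddHom fun w =>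
    (MonoidAlgebra.singleAddHom w).comp
      (AddMonoidHom.mulLeft ((2 : ℂ) ^ LeavittWord.degree w))).comp
    MonoidAlgebra.coeffAddEquiv.toAddMonoidHom

theorem gauge_single (w : LeavittWord V E) (c : ℂ) :
    gauge (MonoidAlgebra.single w c) =
      MonoidAlgebra.single w ((2 : ℂ) ^ LeavittWord.degree w * c) := by
  simp [gauge]

theorem gauge_gen (x : LeavittGen V E) : gauge (gen x) = (2 : ℂ) ^ x.degree • gen x := by
  simp [gen, gauge_single, LeavittWord.degree_of]

theorem gauge_smul (c : ℂ) (a : LeavittFree V E) : gauge (c • a) = c • gauge a := by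
  induction a using MonoidAlgebra.induction_linear with
  | zero => simp
  | add f g hf hg => rw [smul_add, map_add, hf, hg, map_add, smul_add]
  | single w d => simp [gauge_single, mul_left_comm]

theorem gauge_mul (a b : LeavittFree V E) : gauge (a * b) = gauge a * gauge b := by
  induction a using MonoidAlgebra.induction_linear with
  | zero => simp
  | add f g hf hg => rw [add_mul, map_add, hf, hg, map_add, add_mul]
  | single w d =>
    induction b using MonoidAlgebra.induction_linear with
    | zero => simp
    | add f g hf hg => rw [mul_add, map_add, hf, hg, map_add, mul_add]
    | single w' d' =>
      simp only [MonoidAlgebra.single_mul_single, gauge_single, LeavittWord.degree_mul]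
      rw [zpow_add₀ two_ne_zero]
      congr 1
      ring

end LeavittFree

namespace DirectedGraph

variable {V E : Type*} (Γ : DirectedGraph V E)

open LeavittFree

/-- The defining relations of the Leavitt path algebra. The last one is imposed at the regular
vertices `v`, i.e. those with `0 < |s⁻¹(v)| < ∞`. -/
inductive LeavittRel : LeavittFree V E → LeavittFree V E → Prop
  | vertex_mul_self (v : V) : LeavittRel (vertex v * vertex v) (vertex v)
  | vertex_mul_ne (v w : V) (h : v ≠ w) : LeavittRel (vertex v * vertex w) 0
  | source_mul_edge (e : E) : LeavittRel (vertex (Γ.source e) * edge e) (edge e)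
  | edge_mul_range (e : E) : LeavittRel (edge e * vertex (Γ.range e)) (edge e)
  | range_mul_ghost (e : E) : LeavittRel (vertex (Γ.range e) * ghost e) (ghost e)
  | ghost_mul_source (e : E) : LeavittRel (ghost e * vertex (Γ.source e)) (ghost e)
  | ghost_mul_edge_self (e : E) : LeavittRel (ghost e * edge e) (vertex (Γ.range e))
  | ghost_mul_edge_ne (e f : E) (h : e ≠ f) : LeavittRel (ghost e * edge f) 0
  | cuntzKrieger (v : V) (hne : {e | Γ.source e = v}.Nonempty)
      (hfin : {e | Γ.source e = v}.Finite) :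
      LeavittRel (∑ e ∈ hfin.toFinset, edge e * ghost e) (vertex v)

/-- The congruence of complex algebras generated by the defining relations. As the free algebra has
no identity, closure under scalar multiplication is put in by hand. -/
noncomputable def leavittCon : RingCon (LeavittFree V E) :=
  ringConGen fun x y => ∃ (c : ℂ) (a b : LeavittFree V E), Γ.LeavittRel a b ∧ x = c • a ∧ y = c • b

/-- The complex Leavitt path algebra of the graph, as a possibly non-unital algebra: the algebra
generated by vertices, edges and ghost edges subject to the defining relations. -/
def LeavittPathAlgebra : Type _ := Γ.leavittCon.Quotient

theorem leavittCon_of_rel {a b : LeavittFree V E} (h : Γ.LeavittRel a b) : Γ.leavittCon a b :=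
  RingConGen.Rel.of _ _ ⟨1, a, b, h, (one_smul _ _).symm, (one_smul _ _).symm⟩

theorem leavittCon_smul_of_rel (c : ℂ) {a b : LeavittFree V E} (h : Γ.LeavittRel a b) :
    Γ.leavittCon (c • a) (c • b) :=
  RingConGen.Rel.of _ _ ⟨c, a, b, h, rfl, rfl⟩

theorem leavittCon_smul (c : ℂ) {a b : LeavittFree V E} (h : Γ.leavittCon a b) :
    Γ.leavittCon (c • a) (c • b) := by
  change RingConGen.Rel _ a b at h
  induction h with
  | of x y h =>
    obtain ⟨d, a, b, h, rfl, rfl⟩ := h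
    rw [smul_smul, smul_smul]
    exact Γ.leavittCon_smul_of_rel _ h
  | refl x => exact Γ.leavittCon.refl _
  | symm _ ih => exact Γ.leavittCon.symm ih
  | trans _ _ ih ih' => exact Γ.leavittCon.trans ih ih'
  | add _ _ ih ih' => rw [smul_add, smul_add]; exact Γ.leavittCon.add ih ih'
  | @mul w x y z _ h' ih _ =>
    rw [← smul_mul_assoc, ← smul_mul_assoc]; exact Γ.leavittCon.mul ih h'

theorem leavittCon_adj {a b : LeavittFree V E} (h : Γ.leavittCon a b) :
    Γ.leavittCon (adj a) (adj b) := by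
  change RingConGen.Rel _ a b at h
  induction h with
  | of x y h =>
    obtain ⟨d, a, b, h, rfl, rfl⟩ := h
    rw [adj_smul, adj_smul]
    apply leavittCon_smul_of_rel
    cases h with
    | vertex_mul_self v => simpa only [adj_mul, adj_gen, LeavittGen.adj] using LeavittRel.vertex_mul_self v
    | vertex_mul_ne v w h =>
      simpa only [adj_mul, adj_gen, LeavittGen.adj, map_zero] using LeavittRel.vertex_mul_ne w v h.symm
    | source_mul_edge e => simpa only [adj_mul, adj_gen, LeavittGen.adj] using LeavittRel.ghost_mul_source e
    | edge_mul_range e => simpa only [adj_mul, adj_gen, LeavittGen.adj] using LeavittRel.range_mul_ghost e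
    | range_mul_ghost e => simpa only [adj_mul, adj_gen, LeavittGen.adj] using LeavittRel.edge_mul_range e
    | ghost_mul_source e => simpa only [adj_mul, adj_gen, LeavittGen.adj] using LeavittRel.source_mul_edge e
    | ghost_mul_edge_self e =>
      simpa only [adj_mul, adj_gen, LeavittGen.adj] using LeavittRel.ghost_mul_edge_self e
    | ghost_mul_edge_ne e f h =>
      simpa only [adj_mul, adj_gen, LeavittGen.adj, map_zero] using LeavittRel.ghost_mul_edge_ne f e h.symm
    | cuntzKrieger v hne hfin =>
      simpa only [map_sum, adj_mul, adj_gen, LeavittGen.adj] using LeavittRel.cuntzKrieger v hne hfin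
  | refl x => exact Γ.leavittCon.refl _
  | symm _ ih => exact Γ.leavittCon.symm ih
  | trans _ _ ih ih' => exact Γ.leavittCon.trans ih ih'
  | add _ _ ih ih' => rw [map_add adj, map_add adj]; exact Γ.leavittCon.add ih ih'
  | mul _ _ ih ih' => rw [adj_mul, adj_mul]; exact Γ.leavittCon.mul ih' ih

theorem leavittCon_gauge {a b : LeavittFree V E} (h : Γ.leavittCon a b) :
    Γ.leavittCon (gauge a) (gauge b) := by
  change RingConGen.Rel _ a b at h
  induction h with
  | of x y h =>
    obtain ⟨d, a, b, h, rfl, rfl⟩ := h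
    rw [gauge_smul, gauge_smul]
    apply leavittCon_smul
    have key : ∃ c : ℂ, gauge a = c • a ∧ gauge b = c • b := by
      cases h with
      | source_mul_edge e => exact ⟨2, by
        simp [gauge_mul, gauge_gen, LeavittGen.degree, mul_smul_comm]⟩
      | edge_mul_range e => exact ⟨2, by
        simp [gauge_mul, gauge_gen, LeavittGen.degree, smul_mul_assoc]⟩
      | range_mul_ghost e => exact ⟨2⁻¹, by
        simp [gauge_mul, gauge_gen, LeavittGen.degree, mul_smul_comm]⟩
      | ghost_mul_source e => exact ⟨2⁻¹, by
        simp [gauge_mul, gauge_gen, LeavittGen.degree, smul_mul_assoc]⟩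
      | _ => exact ⟨1, by
        simp [gauge_mul, gauge_gen, LeavittGen.degree, smul_mul_assoc, mul_smul_comm, smul_smul]⟩
    obtain ⟨c, h1, h2⟩ := key
    rw [h1, h2]
    exact Γ.leavittCon_smul_of_rel c h
  | refl x => exact Γ.leavittCon.refl _
  | symm _ ih => exact Γ.leavittCon.symm ih
  | trans _ _ ih ih' => exact Γ.leavittCon.trans ih ih'
  | add _ _ ih ih' =>
    rw [map_add LeavittFree.gauge, map_add LeavittFree.gauge]; exact Γ.leavittCon.add ih ih'
  | mul _ _ ih ih' => rw [gauge_mul, gauge_mul]; exact Γ.leavittCon.mul ih ih'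

namespace LeavittPathAlgebra

noncomputable instance : NonUnitalRing Γ.LeavittPathAlgebra :=
  inferInstanceAs (NonUnitalRing Γ.leavittCon.Quotient)

/-- The quotient map from the free algebra. -/
noncomputable def mk (a : LeavittFree V E) : Γ.LeavittPathAlgebra := (a : Γ.leavittCon.Quotient)

theorem mk_surjective : Function.Surjective (mk Γ) := Quotient.mk''_surjective

theorem mk_eq_mk {a b : LeavittFree V E} : mk Γ a = mk Γ b ↔ Γ.leavittCon a b :=
  RingCon.eq _

theorem mk_zero : mk Γ 0 = 0 := rfl
theorem mk_add (a b : LeavittFree V E) : mk Γ (a + b) = mk Γ a + mk Γ b := rfl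
theorem mk_mul (a b : LeavittFree V E) : mk Γ (a * b) = mk Γ a * mk Γ b := rfl

noncomputable instance : SMul ℂ Γ.LeavittPathAlgebra where
  smul c := Quotient.map' (c • ·) fun _ _ h => Γ.leavittCon_smul c h

theorem mk_smul (c : ℂ) (a : LeavittFree V E) : mk Γ (c • a) = c • mk Γ a := rfl

/-- The quotient map, as an additive map. -/
noncomputable def mkAddHom : LeavittFree V E →+ Γ.LeavittPathAlgebra where
  toFun := mk Γ
  map_zero' := mk_zero Γ
  map_add' := mk_add Γ

noncomputable instance : Module ℂ Γ.LeavittPathAlgebra :=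
  Function.Surjective.module ℂ (mkAddHom Γ) (mk_surjective Γ) (mk_smul Γ)

instance : IsScalarTower ℂ Γ.LeavittPathAlgebra Γ.LeavittPathAlgebra where
  smul_assoc c x y := by
    obtain ⟨a, rfl⟩ := mk_surjective Γ x
    obtain ⟨b, rfl⟩ := mk_surjective Γ y
    simp only [smul_eq_mul, ← mk_smul, ← mk_mul, smul_mul_assoc]

instance : SMulCommClass ℂ Γ.LeavittPathAlgebra Γ.LeavittPathAlgebra where
  smul_comm c x y := by
    obtain ⟨a, rfl⟩ := mk_surjective Γ x
    obtain ⟨b, rfl⟩ := mk_surjective Γ y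
    simp only [smul_eq_mul, ← mk_smul, ← mk_mul, mul_smul_comm]

/-- The involution: conjugate-linear, anti-multiplicative, fixing the vertices and interchanging
edges and ghost edges. -/
noncomputable instance : StarRing Γ.LeavittPathAlgebra where
  star := Quotient.map' adj fun _ _ h => Γ.leavittCon_adj h
  star_involutive x := by
    obtain ⟨a, rfl⟩ := mk_surjective Γ x
    exact congrArg (mk Γ) (adj_adj a)
  star_mul x y := by
    obtain ⟨a, rfl⟩ := mk_surjective Γ x
    obtain ⟨b, rfl⟩ := mk_surjective Γ y
    exact congrArg (mk Γ) (adj_mul a b)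
  star_add x y := by
    obtain ⟨a, rfl⟩ := mk_surjective Γ x
    obtain ⟨b, rfl⟩ := mk_surjective Γ y
    exact congrArg (mk Γ) (map_add adj a b)

theorem star_mk (a : LeavittFree V E) : star (mk Γ a) = mk Γ (adj a) := rfl

instance : StarModule ℂ Γ.LeavittPathAlgebra where
  star_smul c x := by
    obtain ⟨a, rfl⟩ := mk_surjective Γ x
    rw [← mk_smul, star_mk, adj_smul, mk_smul, star_mk]

/-- The class of a word (a monomial in the generators). -/
noncomputable def monomial (w : LeavittWord V E) : Γ.LeavittPathAlgebra :=
  mk Γ (MonoidAlgebra.single w 1)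

theorem monomial_mul (w w' : LeavittWord V E) :
    monomial Γ (w * w') = monomial Γ w * monomial Γ w' := by
  simp [monomial, ← mk_mul, MonoidAlgebra.single_mul_single]

theorem star_monomial (w : LeavittWord V E) :
    star (monomial Γ w) = monomial Γ (LeavittWord.adj w) := by
  simp [monomial, star_mk, adj_single]

/-- The homogeneous component of degree `n`: the span of the monomials of degree `n`, where
vertices, edges and ghost edges have degree `0`, `1` and `-1`. -/
noncomputable def homogeneous (n : ℤ) : Submodule ℂ Γ.LeavittPathAlgebra :=
  Submodule.span ℂ {x | ∃ w : LeavittWord V E, LeavittWord.degree w = n ∧ x = monomial Γ w}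

theorem monomial_mem (w : LeavittWord V E) :
    monomial Γ w ∈ homogeneous Γ (LeavittWord.degree w) :=
  Submodule.subset_span ⟨w, rfl, rfl⟩

theorem homogeneous_mul_mem (m n : ℤ) (a b : Γ.LeavittPathAlgebra) (ha : a ∈ homogeneous Γ m)
    (hb : b ∈ homogeneous Γ n) : a * b ∈ homogeneous Γ (m + n) := by
  induction ha using Submodule.span_induction with
  | mem x hx =>
    obtain ⟨w, rfl, rfl⟩ := hx
    induction hb using Submodule.span_induction with
    | mem y hy =>
      obtain ⟨w', rfl, rfl⟩ := hy
      rw [← monomial_mul, ← LeavittWord.degree_mul]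
      exact monomial_mem Γ _
    | zero => simp
    | add y z _ _ hy hz => rw [mul_add]; exact add_mem hy hz
    | smul c y _ hy => rw [mul_smul_comm]; exact Submodule.smul_mem _ _ hy
  | zero => simp
  | add y z _ _ hy hz => rw [add_mul]; exact add_mem hy hz
  | smul c y _ hy => rw [smul_mul_assoc]; exact Submodule.smul_mem _ _ hy

theorem star_mem_homogeneous (n : ℤ) (a : Γ.LeavittPathAlgebra) (ha : a ∈ homogeneous Γ n) :
    star a ∈ homogeneous Γ (-n) := by
  induction ha using Submodule.span_induction with
  | mem x hx =>
    obtain ⟨w, rfl, rfl⟩ := hx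
    rw [star_monomial, ← LeavittWord.degree_adj]
    exact monomial_mem Γ _
  | zero => simp
  | add y z _ _ hy hz => rw [star_add]; exact add_mem hy hz
  | smul c y _ hy => rw [star_smul]; exact Submodule.smul_mem _ _ hy

theorem iSup_homogeneous : ⨆ n, homogeneous Γ n = ⊤ := by
  rw [eq_top_iff]
  rintro x -
  obtain ⟨a, rfl⟩ := mk_surjective Γ x
  induction a using MonoidAlgebra.induction_linear with
  | zero => rw [mk_zero]; exact zero_mem _
  | add f g hf hg => rw [mk_add]; exact add_mem hf hg
  | single w c =>
    have h : mk Γ (MonoidAlgebra.single w c) = c • monomial Γ w := by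
      simp [monomial, ← mk_smul]
    rw [h]
    exact Submodule.smul_mem _ _
      (Submodule.mem_iSup_of_mem (LeavittWord.degree w) (monomial_mem Γ w))

/-- The linear map multiplying each monomial of degree `n` by `2 ^ n`. -/
noncomputable def gaugeEnd : Module.End ℂ Γ.LeavittPathAlgebra where
  toFun := Quotient.map' gauge fun _ _ h => Γ.leavittCon_gauge h
  map_add' x y := by
    obtain ⟨a, rfl⟩ := mk_surjective Γ x
    obtain ⟨b, rfl⟩ := mk_surjective Γ y
    exact congrArg (mk Γ) (map_add gauge a b)
  map_smul' c x := by
    obtain ⟨a, rfl⟩ := mk_surjective Γ x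
    exact congrArg (mk Γ) (gauge_smul c a)

theorem homogeneous_le_eigenspace (n : ℤ) :
    homogeneous Γ n ≤ (gaugeEnd Γ).eigenspace ((2 : ℂ) ^ n) := by
  refine Submodule.span_le.2 ?_
  rintro x ⟨w, rfl, rfl⟩
  refine Module.End.mem_eigenspace_iff.2 ?_
  have h : gauge (MonoidAlgebra.single w (1 : ℂ)) =
      (2 : ℂ) ^ LeavittWord.degree w • MonoidAlgebra.single w (1 : ℂ) := by
    simp [gauge_single]
  exact congrArg (mk Γ) h

theorem iSupIndep_homogeneous : iSupIndep (homogeneous Γ) := by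
  have hinj : Function.Injective fun n : ℤ => (2 : ℂ) ^ n := by
    intro m n h
    have h' : ((2 : ℝ) ^ m) = 2 ^ n := by
      have := congrArg (fun z : ℂ => ‖z‖) h
      simpa [norm_zpow] using this
    exact zpow_right_injective₀ (by norm_num) (by norm_num) h'
  exact ((gaugeEnd Γ).eigenspaces_iSupIndep.comp hinj).mono (homogeneous_le_eigenspace Γ)

/-- The natural `ℤ`-grading, making the Leavitt path algebra a graded star-ring. -/
noncomputable def grading : StarRingGrading ℤ Γ.LeavittPathAlgebra where
  comp n := (homogeneous Γ n).toAddSubgroup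
  isInternal :=
    (DirectSum.isInternal_submodule_iff_iSupIndep_and_iSup_eq_top (homogeneous Γ)).2
      ⟨iSupIndep_homogeneous Γ, iSup_homogeneous Γ⟩
  mul_mem := homogeneous_mul_mem Γ
  star_comp n := by
    ext x
    constructor
    · rintro ⟨a, ha, rfl⟩
      exact star_mem_homogeneous Γ n a ha
    · intro hx
      refine ⟨star x, ?_, star_star x⟩
      have h := star_mem_homogeneous Γ (-n) x hx
      rwa [neg_neg] at h

end LeavittPathAlgebra

end DirectedGraph

/-! If Parseval columns exist, then for $c\in L_{g+h}$ the identity $c=\sum_i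
(c\,z_{h,i}^*)\,z_{h,i}$ puts $c$ in $L_gL_h$.

Conversely, Parseval columns of degrees $g$ and $h$ multiply entrywise to one of degree $g+h$
(`HasParsevalColumn.add`), so over $\mathbb Z$ only degrees $\pm1$ matter.

Every homogeneous element is a combination of $\alpha\beta^*$ with paths $\alpha,\beta$ of the same
range. Degree $-1$: an element of $L_1$ is fixed by left multiplication by $\sum_{e\in F}ee^*$ for
every large enough finite $F$. Since $1\in L_1L_{-1}$, this gives $1=\sum_{e\in F}ee^*$, and the
$e^*$ form the column.

Degree $1$: iterating that identity gives $1=\sum_i x_ix_i^*$ with $x_i$ paths of length $N$ (or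
zero). If for each nonzero $x_i$ some path $y_i$ of length $N+1$ has the same range, then
$z_i=y_ix_i^*$ has degree $1$ and $z_i^*z_i=x_iy_i^*y_ix_i^*=x_ix_i^*$. Such $y_i$ exist for
suitable $N$ because $1\in L_{-1}L_1$ (`exists_star_path_mul_eq_zero`, `exists_path_succ`).

Paths are handled as elements of $L$. That they are nonzero is never needed: zero is carried along
as an alternative. -/

namespace DirectedGraph

namespace LeavittPathAlgebra

variable {V E : Type*} (Γ : DirectedGraph V E)

/-! ### Relations between vertices and edges in the quotient -/

/-- The vertex `v` in the Leavitt path algebra. -/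
noncomputable def vtx (v : V) : Γ.LeavittPathAlgebra := mk Γ (LeavittFree.vertex v)

/-- The edge `e` in the Leavitt path algebra. -/
noncomputable def edg (e : E) : Γ.LeavittPathAlgebra := mk Γ (LeavittFree.edge e)

theorem star_vtx (v : V) : star (vtx Γ v) = vtx Γ v := by
  rw [vtx, star_mk, LeavittFree.adj_gen]; rfl

theorem mk_ghost (e : E) : mk Γ (LeavittFree.ghost e) = star (edg Γ e) := by
  rw [edg, star_mk, LeavittFree.adj_gen]; rfl

theorem vtx_mul_self (v : V) : vtx Γ v * vtx Γ v = vtx Γ v :=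
  (mk_eq_mk Γ).2 (Γ.leavittCon_of_rel (.vertex_mul_self v))

theorem vtx_mul_ne {v w : V} (h : v ≠ w) : vtx Γ v * vtx Γ w = 0 :=
  (mk_eq_mk Γ).2 (Γ.leavittCon_of_rel (.vertex_mul_ne v w h))

theorem source_mul_edg (e : E) : vtx Γ (Γ.source e) * edg Γ e = edg Γ e :=
  (mk_eq_mk Γ).2 (Γ.leavittCon_of_rel (.source_mul_edge e))

theorem edg_mul_range (e : E) : edg Γ e * vtx Γ (Γ.range e) = edg Γ e :=
  (mk_eq_mk Γ).2 (Γ.leavittCon_of_rel (.edge_mul_range e))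

theorem star_edg_mul_source (e : E) :
    star (edg Γ e) * vtx Γ (Γ.source e) = star (edg Γ e) := by
  simpa [star_vtx] using congrArg star (source_mul_edg Γ e)

theorem star_edg_mul_edg (e : E) : star (edg Γ e) * edg Γ e = vtx Γ (Γ.range e) := by
  rw [← mk_ghost]
  exact (mk_eq_mk Γ).2 (Γ.leavittCon_of_rel (.ghost_mul_edge_self e))

theorem star_edg_mul_edg_ne {e f : E} (h : e ≠ f) : star (edg Γ e) * edg Γ f = 0 := by
  rw [← mk_ghost]
  exact (mk_eq_mk Γ).2 (Γ.leavittCon_of_rel (.ghost_mul_edge_ne e f h))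

theorem vtx_mul_edg_ne {v : V} {e : E} (h : v ≠ Γ.source e) : vtx Γ v * edg Γ e = 0 := by
  rw [← source_mul_edg, ← mul_assoc, vtx_mul_ne Γ h, zero_mul]

theorem vtx_mem (v : V) : vtx Γ v ∈ homogeneous Γ 0 := by
  have h := monomial_mem Γ (FreeSemigroup.of (LeavittGen.vertex v : LeavittGen V E))
  rwa [LeavittWord.degree_of] at h

theorem edg_mem (e : E) : edg Γ e ∈ homogeneous Γ 1 := by
  have h := monomial_mem Γ (FreeSemigroup.of (LeavittGen.edge e : LeavittGen V E))
  rwa [LeavittWord.degree_of] at h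

/-! ### Paths and their products with adjoints of paths -/

/-- `IsPath Γ k v w x`: the element `x` is a path of length `k` from `v` to `w`. -/
inductive IsPath : ℕ → V → V → Γ.LeavittPathAlgebra → Prop
  | nil (v : V) : IsPath 0 v v (vtx Γ v)
  | cons (e : E) {k : ℕ} {w : V} {x : Γ.LeavittPathAlgebra} (h : IsPath k (Γ.range e) w x) :
      IsPath (k + 1) (Γ.source e) w (edg Γ e * x)

variable {Γ}

namespace IsPath

variable {k l : ℕ} {u v w : V} {x y : Γ.LeavittPathAlgebra}

theorem source_mul (h : IsPath Γ k v w x) : vtx Γ v * x = x := by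
  cases h with
  | nil => exact vtx_mul_self Γ _
  | cons e h => rw [← mul_assoc, source_mul_edg]

theorem mul_range (h : IsPath Γ k v w x) : x * vtx Γ w = x := by
  induction h with
  | nil => exact vtx_mul_self Γ _
  | cons e h ih => rw [mul_assoc, ih]

theorem range_mul_star (h : IsPath Γ k v w x) : vtx Γ w * star x = star x := by
  simpa [star_vtx] using congrArg star h.mul_range

theorem vtx_mul_eq_zero (h : IsPath Γ k v w x) (huv : u ≠ v) : vtx Γ u * x = 0 := by
  rw [← h.source_mul, ← mul_assoc, vtx_mul_ne Γ huv, zero_mul]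

theorem star_mul_self (h : IsPath Γ k v w x) : star x * x = vtx Γ w := by
  induction h with
  | nil => rw [star_vtx, vtx_mul_self]
  | cons e h ih =>
    rw [star_mul, mul_assoc, ← mul_assoc (star (edg Γ e)), star_edg_mul_edg, h.source_mul, ih]

theorem mul (hx : IsPath Γ k u v x) (hy : IsPath Γ l v w y) : IsPath Γ (k + l) u w (x * y) := by
  induction hx with
  | nil => rwa [hy.source_mul, zero_add]
  | cons e h ih =>
    rw [mul_assoc, add_right_comm]
    exact .cons e (ih hy)

theorem edg (e : E) : IsPath Γ 1 (Γ.source e) (Γ.range e) (edg Γ e) := by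
  have h := IsPath.cons e (IsPath.nil (Γ := Γ) (Γ.range e))
  rwa [edg_mul_range] at h

theorem mem_homogeneous (h : IsPath Γ k v w x) : x ∈ homogeneous Γ k := by
  induction h with
  | nil => exact vtx_mem Γ _
  | cons e h ih =>
    have := homogeneous_mul_mem Γ _ _ _ _ (edg_mem Γ e) ih
    rwa [add_comm, ← Nat.cast_succ] at this

/-- A path of length `k` is either an initial segment of a longer path, or orthogonal to it. -/
theorem star_mul_of_le {u' : V} (hx : IsPath Γ k u v x) (hy : IsPath Γ l u' w y) (hkl : k ≤ l) :
    star x * y = 0 ∨ IsPath Γ (l - k) v w (star x * y) := by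
  induction hx generalizing l u' y with
  | nil a =>
    rw [star_vtx]
    by_cases h : a = u'
    · subst h
      rw [hy.source_mul]
      exact .inr hy
    · exact .inl (hy.vtx_mul_eq_zero h)
  | cons e h ih =>
    cases hy with
    | nil => omega
    | cons f h' =>
      rw [star_mul, mul_assoc, ← mul_assoc (star (LeavittPathAlgebra.edg Γ e))]
      -- Only the first edges are compared: equal ones cancel and shorten both paths by one,
      -- distinct ones annihilate.
      by_cases hef : e = f
      · subst hef
        rw [star_edg_mul_edg, h'.source_mul, Nat.add_sub_add_right]
        exact ih h' (by omega)
      · rw [star_edg_mul_edg_ne Γ hef, zero_mul, mul_zero]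
        exact .inl rfl

end IsPath

/-! ### Spanning of the homogeneous components by products $xy^*$ -/

/-- Every monomial vanishes or has the form `x y^*` with paths `x`, `y` of the same range. -/
theorem monomial_eq_zero_or (m : LeavittWord V E) :
    monomial Γ m = 0 ∨ ∃ (k l : ℕ) (a b u : V) (x y : Γ.LeavittPathAlgebra),
      IsPath Γ k a u x ∧ IsPath Γ l b u y ∧ LeavittWord.degree m = k - l ∧
        monomial Γ m = x * star y := by
  induction m using FreeSemigroup.recOnMul with
  | ih1 g =>
    rw [LeavittWord.degree_of]
    right
    cases g with
    | vertex v =>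
      refine ⟨0, 0, v, v, v, _, _, .nil v, .nil v, by simp [LeavittGen.degree], ?_⟩
      rw [star_vtx, vtx_mul_self]; rfl
    | edge e =>
      refine ⟨1, 0, _, _, _, _, _, .edg e, .nil _, by simp [LeavittGen.degree], ?_⟩
      rw [star_vtx, edg_mul_range]; rfl
    | ghost e =>
      refine ⟨0, 1, _, _, _, _, _, .nil _, .edg e, by simp [LeavittGen.degree], ?_⟩
      rw [(IsPath.edg e).range_mul_star, ← mk_ghost]; rfl
  | ih2 g m _ hm =>
    rw [monomial_mul, LeavittWord.degree_mul, LeavittWord.degree_of]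
    obtain hm | ⟨k, l, a, b, u, x, y, hx, hy, hd, hm⟩ := hm
    · rw [hm, mul_zero]; exact .inl rfl
    rw [hm, hd]
    cases g with
    | vertex v =>
      change vtx Γ v * _ = 0 ∨ ∃ (k l : ℕ) (a b u : V) (x y : Γ.LeavittPathAlgebra),
        _ ∧ _ ∧ _ ∧ vtx Γ v * _ = _
      rw [← mul_assoc]
      by_cases h : v = a
      · subst h
        rw [hx.source_mul]
        exact .inr ⟨k, l, v, b, u, x, y, hx, hy, by simp [LeavittGen.degree], rfl⟩
      · rw [hx.vtx_mul_eq_zero h, zero_mul]; exact .inl rfl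
    | edge e =>
      change edg Γ e * _ = 0 ∨ ∃ (k l : ℕ) (a b u : V) (x y : Γ.LeavittPathAlgebra),
        _ ∧ _ ∧ _ ∧ edg Γ e * _ = _
      rw [← mul_assoc]
      by_cases h : Γ.range e = a
      · subst h
        exact .inr ⟨k + 1, l, _, b, u, _, y, .cons e hx, hy,
          by push_cast [LeavittGen.degree]; ring, rfl⟩
      · rw [← edg_mul_range, mul_assoc (edg Γ e), hx.vtx_mul_eq_zero h, mul_zero, zero_mul]
        exact .inl rfl
    | ghost e =>
      change mk Γ (LeavittFree.ghost e) * _ = 0 ∨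
        ∃ (k l : ℕ) (a b u : V) (x y : Γ.LeavittPathAlgebra),
          _ ∧ _ ∧ _ ∧ mk Γ (LeavittFree.ghost e) * _ = _
      rw [mk_ghost, ← mul_assoc]
      -- A ghost edge meeting a trivial path is absorbed on the right, as $e^*y^*=(ye)^*$; meeting a
      -- path of positive length it cancels the first edge or kills it.
      cases hx with
      | nil =>
        by_cases h : a = Γ.source e
        · subst h
          rw [star_edg_mul_source, ← star_mul]
          have hye := hy.mul (.edg e)
          refine .inr ⟨0, l + 1, _, b, _, _, _, .nil _, hye,
            by push_cast [LeavittGen.degree]; ring, ?_⟩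
          rw [hye.range_mul_star]
        · have h0 : star (edg Γ e) * vtx Γ a = 0 := by
            simpa [star_vtx] using congrArg star (vtx_mul_edg_ne Γ h)
          rw [h0, zero_mul]; exact .inl rfl
      | @cons f k _ x hx =>
        rw [← mul_assoc (star (edg Γ e))]
        by_cases h : e = f
        · subst h
          rw [star_edg_mul_edg, hx.source_mul]
          exact .inr ⟨k, l, _, b, u, x, y, hx, hy, by push_cast [LeavittGen.degree]; ring, rfl⟩
        · rw [star_edg_mul_edg_ne Γ h, zero_mul, zero_mul]; exact .inl rfl

-- Reduces any linear statement about $L_n$ to the products $xy^*$ with $|x|-|y|=n$; vanishing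
-- monomials fall under the case `zero`.
@[elab_as_elim]
theorem homogeneous_induction {n : ℤ}
    {p : (c : Γ.LeavittPathAlgebra) → c ∈ homogeneous Γ n → Prop}
    (path : ∀ (k l : ℕ) (a b u : V) (x y : Γ.LeavittPathAlgebra), IsPath Γ k a u x →
      IsPath Γ l b u y → n = k - l → ∀ h, p (x * star y) h)
    (zero : p 0 (zero_mem _))
    (add : ∀ x y hx hy, p x hx → p y hy → p (x + y) (add_mem hx hy))
    (smul : ∀ (c : ℂ) x hx, p x hx → p (c • x) (Submodule.smul_mem _ c hx))
    {c : Γ.LeavittPathAlgebra} (hc : c ∈ homogeneous Γ n) : p c hc := by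
  refine Submodule.span_induction ?_ zero (fun x y hx hy => add x y hx hy)
    (fun c x hx => smul c x hx) hc
  rintro x ⟨m, rfl, rfl⟩
  have hm := monomial_mem Γ m
  change p _ hm
  obtain h | ⟨k, l, a, b, u, x, y, hx, hy, hd, h⟩ := monomial_eq_zero_or (Γ := Γ) m
  · have : ∀ z hz, z = 0 → p z hz := by rintro _ _ rfl; exact zero
    exact this _ hm h
  · have : ∀ z hz, z = x * star y → p z hz := by
      rintro _ hz rfl
      exact path k l a b u x y hx hy hd hz
    exact this _ hm h

/-! ### Finite sums acting as identities, and annihilation by adjoint paths -/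

/-- Finite sums of vertices are local units. Asking for all $F'\supseteq F$ makes the property pass
to sums, by taking unions. -/
theorem exists_finset_sum_vtx_mul (c : Γ.LeavittPathAlgebra) :
    ∃ F : Finset V, ∀ F', F ⊆ F' → (∑ v ∈ F', vtx Γ v) * c = c := by
  classical
  have hc : c ∈ ⨆ n, homogeneous Γ n := iSup_homogeneous Γ ▸ Submodule.mem_top
  have hadd : ∀ x y : Γ.LeavittPathAlgebra,
      (∃ F : Finset V, ∀ F', F ⊆ F' → (∑ v ∈ F', vtx Γ v) * x = x) →
      (∃ F : Finset V, ∀ F', F ⊆ F' → (∑ v ∈ F', vtx Γ v) * y = y) →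
      ∃ F : Finset V, ∀ F', F ⊆ F' → (∑ v ∈ F', vtx Γ v) * (x + y) = x + y := by
    rintro x y ⟨F, hF⟩ ⟨G, hG⟩
    refine ⟨F ∪ G, fun F' h => ?_⟩
    rw [mul_add, hF F' (Finset.union_subset_left h), hG F' (Finset.union_subset_right h)]
  induction hc using Submodule.iSup_induction' with
  | mem n x hx =>
    induction hx using homogeneous_induction with
    | path k l a b u x y hx _ _ _ =>
      refine ⟨{a}, fun F' h => ?_⟩
      rw [← mul_assoc, Finset.sum_mul, Finset.sum_eq_single_of_mem a (h (by simp))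
        fun v _ hv => hx.vtx_mul_eq_zero hv, hx.source_mul]
    | zero => exact ⟨∅, fun _ _ => mul_zero _⟩
    | add x y _ _ hx hy => exact hadd x y hx hy
    | smul c x _ hx =>
      obtain ⟨F, hF⟩ := hx
      exact ⟨F, fun F' h => by rw [mul_smul_comm, hF F' h]⟩
  | zero => exact ⟨∅, fun _ _ => mul_zero _⟩
  | add x y _ _ hx hy => exact hadd x y hx hy

/-- In degree $1$ every spanning product $xy^*$ has $|x|=|y|+1>0$, so $x$ starts with an edge $e$;
then $ee^*$ fixes it and $ff^*$ kills it for $f\ne e$. -/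
theorem exists_finset_sum_edg_mul {c : Γ.LeavittPathAlgebra} (hc : c ∈ homogeneous Γ 1) :
    ∃ F : Finset E, ∀ F', F ⊆ F' → (∑ e ∈ F', edg Γ e * star (edg Γ e)) * c = c := by
  classical
  induction hc using homogeneous_induction with
  | path k l a b u x y hx _ hkl _ =>
    cases hx with
    | nil => exfalso; omega
    | cons e h =>
      refine ⟨{e}, fun F' hF => ?_⟩
      rw [← mul_assoc, ← mul_assoc, Finset.sum_mul,
        Finset.sum_eq_single_of_mem e (hF (by simp)),
        mul_assoc (edg Γ e) (star _), star_edg_mul_edg, edg_mul_range]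
      intro f _ hf
      rw [mul_assoc, star_edg_mul_edg_ne Γ hf, mul_zero]
  | zero => exact ⟨∅, fun _ _ => mul_zero _⟩
  | add x y _ _ hx hy =>
    obtain ⟨F, hF⟩ := hx
    obtain ⟨G, hG⟩ := hy
    refine ⟨F ∪ G, fun F' h => ?_⟩
    rw [mul_add, hF F' (Finset.union_subset_left h), hG F' (Finset.union_subset_right h)]
  | smul c x _ hx =>
    obtain ⟨F, hF⟩ := hx
    exact ⟨F, fun F' h => by rw [mul_smul_comm, hF F' h]⟩

/-- An element of degree `-1` is killed by `μ^*` for every long enough path `μ` whose range is not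
the range of a path that is longer by one. -/
theorem exists_star_path_mul_eq_zero {c : Γ.LeavittPathAlgebra} (hc : c ∈ homogeneous Γ (-1)) :
    ∃ N : ℕ, ∀ n, N ≤ n → ∀ (v w : V) (x : Γ.LeavittPathAlgebra), IsPath Γ n v w x →
      (¬ ∃ (v' : V) (y : Γ.LeavittPathAlgebra), IsPath Γ (n + 1) v' w y) → star x * c = 0 := by
  induction hc using homogeneous_induction with
  | path k l a b u α β hα hβ hkl _ =>
    -- The threshold is $|\alpha|$: from there on, $\alpha$ is either an initial segment of $x$ or
    -- orthogonal to it.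
    refine ⟨k, fun n hn v w x hx hno => ?_⟩
    obtain h | h := hα.star_mul_of_le hx hn
    · have h' : star x * α = 0 := by simpa using congrArg star h
      rw [← mul_assoc, h', zero_mul]
    -- Here $x=\alpha x'$ with $x'=\alpha^*x$, and replacing $\alpha$ by the longer $\beta$ gives a
    -- path $\beta x'$ of length $n+1$ with the range of $x$, as $|\beta|=|\alpha|+1$.
    · have hβx := hβ.mul h
      rw [show l + (n - k) = n + 1 by omega] at hβx
      exact absurd ⟨b, _, hβx⟩ hno
  | zero => exact ⟨0, fun _ _ _ _ _ _ _ => mul_zero _⟩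
  | add x y _ _ hx hy =>
    obtain ⟨N, hN⟩ := hx
    obtain ⟨M, hM⟩ := hy
    refine ⟨max N M, fun n hn v w z hz hno => ?_⟩
    rw [mul_add, hN n (le_of_max_le_left hn) v w z hz hno,
      hM n (le_of_max_le_right hn) v w z hz hno, add_zero]
  | smul c x _ hx =>
    obtain ⟨N, hN⟩ := hx
    exact ⟨N, fun n hn v w z hz hno => by rw [mul_smul_comm, hN n hn v w z hz hno, smul_zero]⟩

end LeavittPathAlgebra

end DirectedGraph

/-! ### Parseval columns in a graded star-ring -/

theorem IsRingIdentity.star_eq {S : Type*} [NonUnitalRing S] [StarRing S] {one : S}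
    (h : IsRingIdentity one) : star one = one := by
  rw [← (h (star one)).1]
  simpa using congrArg star (h (star one)).1

namespace StarRingGrading

variable {G S : Type*} [AddGroup G] [DecidableEq G] [NonUnitalRing S] [StarRing S]
  (𝒮 : StarRingGrading G S) (one : S)

/-- There is a column `z` with entries of degree `g` such that `(z^*)^t z = 1`. -/
def HasParsevalColumn (g : G) : Prop :=
  ∃ (n : ℕ) (z : Fin n → S), (∀ i, z i ∈ 𝒮.comp g) ∧ ∑ i, star (z i) * z i = one

variable {𝒮 one}

theorem star_mem {g : G} {a : S} (ha : a ∈ 𝒮.comp g) : star a ∈ 𝒮.comp (-g) := by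
  have h : star a ∈ (𝒮.comp (-g) : Set S) := by
    rw [← 𝒮.star_comp g]
    exact ⟨a, ha, rfl⟩
  exact h

theorem hasParsevalColumn_of_finset {ι : Type*} {g : G} (F : Finset ι) (z : ι → S)
    (hz : ∀ i ∈ F, z i ∈ 𝒮.comp g) (h : ∑ i ∈ F, star (z i) * z i = one) :
    𝒮.HasParsevalColumn one g := by
  refine ⟨F.card, fun i => z (F.equivFin.symm i), fun i => hz _ (F.equivFin.symm i).2, ?_⟩
  rw [← h, ← Finset.sum_coe_sort F]
  exact Equiv.sum_comp F.equivFin.symm fun i : F => star (z i) * z i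

/-- With entries $x_iy_j$ the sum telescopes: $\sum_j y_j^*\bigl(\sum_i x_i^*x_i\bigr)y_j=\sum_j
y_j^*y_j=1$. -/
theorem HasParsevalColumn.add {g h : G} (hone : IsRingIdentity one)
    (hg : 𝒮.HasParsevalColumn one g) (hh : 𝒮.HasParsevalColumn one h) :
    𝒮.HasParsevalColumn one (g + h) := by
  obtain ⟨m, x, hx, hxs⟩ := hg
  obtain ⟨n, y, hy, hys⟩ := hh
  refine hasParsevalColumn_of_finset (Finset.univ : Finset (Fin n × Fin m))
    (fun p => x p.2 * y p.1) (fun p _ => 𝒮.mul_mem _ _ _ _ (hx _) (hy _)) ?_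
  rw [Fintype.sum_prod_type, ← hys]
  refine Finset.sum_congr rfl fun j _ => ?_
  have : ∀ i, star (x i * y j) * (x i * y j) = star (y j) * ((star (x i) * x i) * y j) := by
    intro i; simp only [star_mul, mul_assoc]
  simp only [this]
  rw [← Finset.mul_sum, ← Finset.sum_mul, hxs, (hone _).1]

theorem hasParsevalColumn_zero (hone : IsRingIdentity one) (h0 : one ∈ 𝒮.comp 0) :
    𝒮.HasParsevalColumn one 0 :=
  ⟨1, fun _ => one, fun _ => h0, by simp [(hone _).2, hone.star_eq]⟩

theorem hasAlgebraicParseval_of_columns (hone : IsRingIdentity one) (h0 : one ∈ 𝒮.comp 0)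
    (h : ∀ g, 𝒮.HasParsevalColumn one g) : 𝒮.HasAlgebraicParseval one := by
  have key : ∀ g, ∃ p : Σ n : ℕ, Fin n → S, 0 < p.1 ∧ (∀ i, p.2 i ∈ 𝒮.comp g) ∧
      ∑ i, star (p.2 i) * p.2 i = one ∧ (g = 0 → p.1 = 1 ∧ ∀ i, p.2 i = one) := by
    intro g
    by_cases hg : g = 0
    · subst hg
      exact ⟨⟨1, fun _ => one⟩, one_pos, fun _ => h0, by simp [(hone _).2, hone.star_eq],
        fun _ => ⟨rfl, fun _ => rfl⟩⟩
    · obtain ⟨n, z, hz, hs⟩ := h g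
      refine ⟨⟨n + 1, Fin.cons 0 z⟩, n.succ_pos, ?_, ?_, fun h => absurd h hg⟩
      · intro i
        refine Fin.cases ?_ (fun i => ?_) i
        · simp
        · simpa using hz i
      · simpa [Fin.sum_univ_succ] using hs
  choose p hpos hmem hsum hzero using key
  refine ⟨fun g => (p g).1, fun g => (p g).2, hpos, hmem, fun g i => star_mem (hmem g i), hsum,
    (hzero 0 rfl).1, (hzero 0 rfl).2, fun i => ?_⟩
  beta_reduce
  rw [(hzero 0 rfl).2 i, hone.star_eq]

/-- The algebraic Parseval property implies strong grading. -/
theorem HasAlgebraicParseval.isStrong (hone : IsRingIdentity one)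
    (h : 𝒮.HasAlgebraicParseval one) : 𝒮.toRingGrading.IsStrong := by
  obtain ⟨n, z, hz⟩ := h
  intro g h
  refine le_antisymm ((AddSubgroup.closure_le _).2 ?_) fun c hc => ?_
  · rintro _ ⟨a, ha, b, hb, rfl⟩
    exact 𝒮.mul_mem g h a b ha hb
  -- Expand $c=c\cdot1$ with the column of degree $h$; the factor $c\,z_{h,i}^*$ has degree
  -- $(g+h)-h=g$.
  · rw [← (hone c).2, ← hz.sum_eq h, Finset.mul_sum]
    refine sum_mem fun i _ => AddSubgroup.subset_closure
      ⟨c * star (z h i), ?_, z h i, hz.mem_left h i, (mul_assoc _ _ _).symm⟩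
    have := 𝒮.mul_mem _ _ _ _ hc (hz.mem_right h i)
    rwa [add_neg_cancel_right] at this

end StarRingGrading

theorem StarRingGrading.HasParsevalColumn.int {S : Type*} [NonUnitalRing S] [StarRing S]
    {𝒮 : StarRingGrading ℤ S} {one : S} (hone : IsRingIdentity one) (h0 : one ∈ 𝒮.comp 0)
    (h1 : 𝒮.HasParsevalColumn one 1) (h2 : 𝒮.HasParsevalColumn one (-1)) (n : ℤ) :
    𝒮.HasParsevalColumn one n := by
  induction n with
  | zero => exact hasParsevalColumn_zero hone h0
  | succ n ih => exact ih.add hone h1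
  | pred n ih => exact ih.add hone h2

/-! ### Columns of degree $\pm1$ for strongly graded Leavitt path algebras -/

namespace DirectedGraph

namespace LeavittPathAlgebra

variable {V E : Type*} {Γ : DirectedGraph V E} {one : Γ.LeavittPathAlgebra}

theorem exists_finset_sum_vtx_eq (hone : IsRingIdentity one) :
    ∃ F : Finset V, ∑ v ∈ F, vtx Γ v = one := by
  obtain ⟨F, hF⟩ := exists_finset_sum_vtx_mul one
  exact ⟨F, by rw [← hF F subset_rfl, (hone _).2]⟩

theorem one_mem (hone : IsRingIdentity one) : one ∈ homogeneous Γ 0 := by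
  obtain ⟨F, rfl⟩ := exists_finset_sum_vtx_eq hone
  exact sum_mem fun v _ => vtx_mem Γ v

theorem one_mem_closure (hone : IsRingIdentity one) (hs : (grading Γ).toRingGrading.IsStrong)
    (n : ℤ) : one ∈ AddSubgroup.closure
      {c | ∃ a ∈ homogeneous Γ n, ∃ b ∈ homogeneous Γ (-n), c = a * b} := by
  have h : one ∈ (grading Γ).comp (n + -n) := by
    rw [add_neg_cancel]
    exact one_mem hone
  rw [← hs] at h
  exact h

/-- Being fixed by all large enough sums $\sum ee^*$ depends only on the left factor of a product,
so it passes from $L_1$ to $L_1L_{-1}\ni1$. -/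
theorem exists_finset_sum_edg_eq (hone : IsRingIdentity one)
    (hs : (grading Γ).toRingGrading.IsStrong) :
    ∃ F : Finset E, ∑ e ∈ F, edg Γ e * star (edg Γ e) = one := by
  classical
  suffices h : ∃ F : Finset E, ∀ F', F ⊆ F' →
      (∑ e ∈ F', edg Γ e * star (edg Γ e)) * one = one by
    obtain ⟨F, hF⟩ := h
    exact ⟨F, by rw [← hF F subset_rfl, (hone _).2]⟩
  have h := one_mem_closure hone hs 1
  clear hone
  induction h using AddSubgroup.closure_induction with
  | mem c hc =>
    obtain ⟨a, ha, b, -, rfl⟩ := hc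
    obtain ⟨F, hF⟩ := exists_finset_sum_edg_mul ha
    exact ⟨F, fun F' h => by rw [← mul_assoc, hF F' h]⟩
  | zero => exact ⟨∅, fun _ _ => mul_zero _⟩
  | add x y _ _ hx hy =>
    obtain ⟨F, hF⟩ := hx
    obtain ⟨G, hG⟩ := hy
    refine ⟨F ∪ G, fun F' h => ?_⟩
    rw [mul_add, hF F' (Finset.union_subset_left h), hG F' (Finset.union_subset_right h)]
  | neg x _ hx =>
    obtain ⟨F, hF⟩ := hx
    exact ⟨F, fun F' h => by rw [mul_neg, hF F' h]⟩

/-- Write $1$ as a finite signed sum of products $ab$ with $a\in L_{-1}$. If $x$ is a long path and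
no path longer by one ends at its range, then $x^*$ kills every $a$, hence $x^*=x^*1=0$. -/
theorem exists_path_succ (hone : IsRingIdentity one) (hs : (grading Γ).toRingGrading.IsStrong) :
    ∃ N : ℕ, ∀ (v w : V) (x : Γ.LeavittPathAlgebra), IsPath Γ N v w x →
      x = 0 ∨ ∃ (v' : V) (y : Γ.LeavittPathAlgebra), IsPath Γ (N + 1) v' w y := by
  suffices h : ∃ N : ℕ, ∀ n, N ≤ n → ∀ (v w : V) (x : Γ.LeavittPathAlgebra), IsPath Γ n v w x →
      (¬ ∃ (v' : V) (y : Γ.LeavittPathAlgebra), IsPath Γ (n + 1) v' w y) → star x * one = 0 by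
    obtain ⟨N, hN⟩ := h
    refine ⟨N, fun v w x hx => or_iff_not_imp_right.2 fun hno => ?_⟩
    have h := hN N le_rfl v w x hx hno
    rwa [(hone _).2, star_eq_zero] at h
  have h := one_mem_closure hone hs (-1)
  clear hone
  induction h using AddSubgroup.closure_induction with
  | mem c hc =>
    obtain ⟨a, ha, b, -, rfl⟩ := hc
    obtain ⟨N, hN⟩ := exists_star_path_mul_eq_zero ha
    exact ⟨N, fun n hn v w x hx hno => by rw [← mul_assoc, hN n hn v w x hx hno, zero_mul]⟩
  | zero => exact ⟨0, fun _ _ _ _ _ _ _ => mul_zero _⟩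
  | add x y _ _ hx hy =>
    obtain ⟨N, hN⟩ := hx
    obtain ⟨M, hM⟩ := hy
    refine ⟨max N M, fun n hn v w z hz hno => ?_⟩
    rw [mul_add, hN n (le_of_max_le_left hn) v w z hz hno,
      hM n (le_of_max_le_right hn) v w z hz hno, add_zero]
  | neg x _ hx =>
    obtain ⟨N, hN⟩ := hx
    exact ⟨N, fun n hn v w z hz hno => by rw [mul_neg, hN n hn v w z hz hno, neg_zero]⟩

/-- A resolution of the identity by the edges yields one by the paths of any given length. -/
theorem exists_sum_path_eq (hone : IsRingIdentity one) {F : Finset E}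
    (hF : ∑ e ∈ F, edg Γ e * star (edg Γ e) = one) (n : ℕ) :
    ∃ (m : ℕ) (x : Fin m → Γ.LeavittPathAlgebra),
      (∀ i, x i = 0 ∨ ∃ v w, IsPath Γ n v w (x i)) ∧ ∑ i, x i * star (x i) = one := by
  induction n with
  | zero =>
    obtain ⟨G, hG⟩ := exists_finset_sum_vtx_eq hone
    refine ⟨G.card, fun i => vtx Γ (G.equivFin.symm i), fun i => .inr ⟨_, _, .nil _⟩, ?_⟩
    simp only [star_vtx, vtx_mul_self]
    rw [← hG, ← Finset.sum_coe_sort G]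
    exact Equiv.sum_comp G.equivFin.symm fun i : G => vtx Γ (i : V)
  | succ n ih =>
    obtain ⟨m, x, hx, hsum⟩ := ih
    let φ : Fin (F.card * m) ≃ F × Fin m :=
      finProdFinEquiv.symm.trans (F.equivFin.symm.prodCongr (Equiv.refl _))
    refine ⟨F.card * m, fun i => edg Γ (φ i).1 * x (φ i).2, fun i => ?_, ?_⟩
    · beta_reduce
      obtain h | ⟨v, w, h⟩ := hx (φ i).2
      · exact .inl (by rw [h, mul_zero])
      -- When $e$ and the path do not compose their product is zero, which is why zero entries are
      -- admitted in the family.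
      · by_cases hv : Γ.range (φ i).1 = v
        · subst hv
          exact .inr ⟨_, _, .cons _ h⟩
        · left
          rw [← edg_mul_range, mul_assoc, h.vtx_mul_eq_zero hv, mul_zero]
    · rw [Equiv.sum_comp φ fun p => edg Γ (p.1 : E) * x p.2 * star (edg Γ (p.1 : E) * x p.2),
        Fintype.sum_prod_type, ← hF, ← Finset.sum_coe_sort F]
      refine Finset.sum_congr rfl fun e _ => ?_
      have : ∀ i, edg Γ (e : E) * x i * star (edg Γ (e : E) * x i) =
          edg Γ (e : E) * (x i * star (x i) * star (edg Γ (e : E))) := by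
        intro i; simp only [star_mul, mul_assoc]
      simp only [this]
      -- For fixed $e$ the inner sum is $e\bigl(\sum_i x_ix_i^*\bigr)e^*=ee^*$.
      rw [← Finset.mul_sum, ← Finset.sum_mul, hsum, (hone _).1]

theorem hasParsevalColumn_neg_one (hs : (grading Γ).toRingGrading.IsStrong)
    (hone : IsRingIdentity one) : (grading Γ).HasParsevalColumn one (-1) := by
  obtain ⟨F, hF⟩ := exists_finset_sum_edg_eq hone hs
  exact StarRingGrading.hasParsevalColumn_of_finset F (fun e => star (edg Γ e))
    (fun e _ => star_mem_homogeneous Γ 1 _ (edg_mem Γ e)) (by simpa using hF)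

theorem hasParsevalColumn_one (hs : (grading Γ).toRingGrading.IsStrong)
    (hone : IsRingIdentity one) : (grading Γ).HasParsevalColumn one 1 := by
  obtain ⟨F, hF⟩ := exists_finset_sum_edg_eq hone hs
  obtain ⟨N, hN⟩ := exists_path_succ hone hs
  obtain ⟨m, x, hx, hsum⟩ := exists_sum_path_eq hone hF N
  have key : ∀ i, ∃ z ∈ homogeneous Γ 1, star z * z = x i * star (x i) := by
    intro i
    have h0 : x i = 0 → ∃ z ∈ homogeneous Γ 1, star z * z = x i * star (x i) :=
      fun h => ⟨0, zero_mem _, by rw [h, mul_zero, zero_mul]⟩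
    obtain h | ⟨v, w, h⟩ := hx i
    · exact h0 h
    · obtain h' | ⟨v', y, hy⟩ := hN v w _ h
      · exact h0 h'
      -- The element $yx_i^*$ has degree $(N+1)-N=1$, and $y^*y$ is the common range vertex, which
      -- $x_i^*$ absorbs.
      · refine ⟨y * star (x i), ?_, ?_⟩
        · have := homogeneous_mul_mem Γ _ _ _ _ hy.mem_homogeneous
            (star_mem_homogeneous Γ _ _ h.mem_homogeneous)
          rwa [show ((N + 1 : ℕ) : ℤ) + -(N : ℤ) = 1 by push_cast; ring] at this
        · rw [star_mul, star_star, mul_assoc, ← mul_assoc (star y), hy.star_mul_self,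
            h.range_mul_star]
  choose z hz hzx using key
  exact ⟨m, z, hz, by simpa only [hzx] using hsum⟩

end LeavittPathAlgebra

end DirectedGraph

theorem theorem2p28 {V E : Type*} (Γ : DirectedGraph V E) (one : Γ.LeavittPathAlgebra)
    (hone : IsRingIdentity one) :
    (DirectedGraph.LeavittPathAlgebra.grading Γ).HasAlgebraicParseval one ↔
      (DirectedGraph.LeavittPathAlgebra.grading Γ).toRingGrading.IsStrong := by
  open DirectedGraph.LeavittPathAlgebra in
  exact ⟨fun h => h.isStrong hone, fun h =>
    StarRingGrading.hasAlgebraicParseval_of_columns hone (one_mem hone)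
      (StarRingGrading.HasParsevalColumn.int hone (one_mem hone)
        (hasParsevalColumn_one h hone) (hasParsevalColumn_neg_one h hone))⟩
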